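/- **Setting.** An instance of bipartite matching with predictions consists of agents $L=[n]$, resources $R=[m]$, public values $v_{ij}>0$ for $(i,j)\in L\times R$, and a public predicted matching $\hat M\subseteq L\times R$. In the private graph model, each agent $i$ has a private set $E_i\subseteq\{i\}\times R$ of truly compatible edges and declares a set $D_i\subseteq\{i\}\times R$; put $D=\bigcup_i D_i$. For $M\subseteq L\times R$ let $v(M)=\sum_{(i,j)\in M}v_{ij}$, and let $M^*_D$ be a matching of maximum value contained in $D$. The prediction error of the instance is $\eta=1-v(\hat M\cap D)/v(M^*_D)$ (and $\eta=0$ if $D=\emptyset$). A deterministic mechanism $\mathcal M$ maps every instance with its declarations to a matching $\mathcal M(D)\subseteq D$. The utility $u_i$ of agent $i$ is $v_{ij}$ if $i$ is matched to $j$ and $(i,j)\in E_i$, and $0$ otherwise. $\mathcal M$ is *strategyproof* if always $u_i(E_i,D_{-i})\ge u_i(D_i',D_{-i})$. It is *group-strategyproof* if for every instance, all $E$ and $D$, every nonempty $S\subseteq L$ and every $D'_S$ there is $i\in S$ with $u_i(E_S,D_{-S})\ge u_i(D'_S,D_{-S})$. It is *$\alpha$-consistent* if $\alpha\, v(\mathcal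 M(D))\ge v(M^*_D)$ whenever $v(\hat M\cap D)=v(M^*_D)$; *$\beta$-robust* if $\beta\, v(\mathcal M(D))\ge v(M^*_D)$ always; and it has *approximation guarantee $g$ for error $\hat\eta$* if $g\, v(\mathcal M(D))\ge v(M^*_D)$ whenever $\eta\le\hat\eta$. **The mechanism Boost** with confidence parameter $\gamma\ge1$. The offer of $i$ to $j$ is $\theta_{ij}=\gamma v_{ij}$ if $(i,j)\in\hat M$ and $\theta_{ij}=v_{ij}$ otherwise. Each agent $i$ orders the resources by decreasing $v_{ij}$, and each resource $j$ orders the agents by decreasing $\theta_{ij}$; ties are broken by fixed strict rules that do not depend on the declarations. Start with the empty tentative matching and $P_i=D_i$ for all $i$. An agent is active if it is tentatively unmatched and $P_i\ne\emptyset$. While there is an active agent, choose one (by any rule), say $i$; it makes the offer $\theta_{ij}$ to the first resource $j$ in its order with $(i,j)\in P_i$. If $j$ is unmatched or prefers $i$ to its current mate, then $j$ rejects its current mate (if any) and is tentatively matched to $i$. In any case $(i,j)$ is removed from $P_i$. When no agent is active, output the tentative matching. **Theorem 4.1.** For every $\gamma\ge1$, all tie-breaking rules and every rule for choosing the active agent,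 Boost is group-strategyproof, and for every $\hat\eta\in[0,1]$ it has for error $\hat\eta$ the approximation guarantee $$g(\hat\eta,\gamma)=\begin{cases}\dfrac{1+\gamma}{\gamma(1-\hat\eta)} & \text{if }\hat\eta\le 1-\frac1\gamma,\\[1ex] 1+\gamma&\text{otherwise.}\end{cases}$$ In particular, Boost is $(1+\frac1\gamma)$-consistent and $(1+\gamma)$-robust. This is best possible: for no $\varepsilon>0$ is there a deterministic strategyproof mechanism that is $(1+\frac1\gamma)$-consistent and $(1+\gamma-\varepsilon)$-robust. -/

import Mathlib

namespace BMP

/-! ### Bipartite matching with predictions in the private graph model -/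

/-- The public data of an instance with agents `L = Fin n` and resources `R = Fin m`, apart from
the declarations: the positive values `v i j`, and a predicted matching `pred` in the complete
bipartite graph on `L` and `R`. -/
structure Instance (n m : ℕ) where
  v : Fin n → Fin m → ℝ
  v_pos : ∀ i j, 0 < v i j
  pred : Finset (Fin n × Fin m)
  pred_agent : ∀ i j k, (i, j) ∈ pred → (i, k) ∈ pred → j = k
  pred_resource : ∀ i k j, (i, j) ∈ pred → (k, j) ∈ pred → i = k

/-- A profile of compatibility sets, one for each agent: `D i` is the set of all resources `j` such
that the edge `(i, j)` is declared (or, for the private graph, is truly compatible). -/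
abbrev Profile (n m : ℕ) := Fin n → Finset (Fin m)

/-- The edge set of the compatibility graph that a profile induces. -/
def Profile.edges {n m : ℕ} (D : Profile n m) : Finset (Fin n × Fin m) :=
  Finset.univ.filter fun e => e.2 ∈ D e.1

/-- `M` is feasible for `D`: a one-to-one assignment that uses edges of `D` only. -/
structure IsFeasible {n m : ℕ} (D : Profile n m) (M : Finset (Fin n × Fin m)) : Prop where
  subset : M ⊆ D.edges
  agent : ∀ i j k, (i, j) ∈ M → (i, k) ∈ M → j = k
  resource : ∀ i k j, (i, j) ∈ M → (k, j) ∈ M → i = k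

theorem isFeasible_empty {n m : ℕ} (D : Profile n m) : IsFeasible D ∅ :=
  ⟨by simp, by simp, by simp⟩

namespace Instance

variable {n m : ℕ}

/-- The value of a set of edges. -/
def value (I : Instance n m) (M : Finset (Fin n × Fin m)) : ℝ :=
  ∑ e ∈ M, I.v e.1 e.2

open Classical in
/-- The value of an optimal (maximum value feasible) matching with respect to `D`. -/
noncomputable def optValue (I : Instance n m) (D : Profile n m) : ℝ :=
  (Finset.univ.filter (IsFeasible D)).sup'
    ⟨∅, Finset.mem_filter.2 ⟨Finset.mem_univ _, isFeasible_empty D⟩⟩ I.value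

/-- The prediction error, one minus the ratio of the value of the declared part of the prediction
and the optimal value. If no edge is declared, the optimal value is `0` and every prediction is
perfect; the error is `0` then. -/
noncomputable def predError (I : Instance n m) (D : Profile n m) : ℝ :=
  if I.optValue D = 0 then 0 else 1 - I.value (I.pred ∩ D.edges) / I.optValue D

/-- The utility of agent `i`, whose true compatibility set is `Ei`, in the matching `M`: the value
of the edge of `M` at `i` if there is one and it is truly compatible, and `0` otherwise (a matching
has at most one edge at `i`, so the sum has at most one term). -/
def utility (I : Instance n m) (Ei : Finset (Fin m)) (M : Finset (Fin n × Fin m))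
    (i : Fin n) : ℝ :=
  ∑ j ∈ Ei.filter (fun j => (i, j) ∈ M), I.v i j

end Instance

/-! ### Mechanisms and their properties -/

/-- A deterministic mechanism: it maps the public data and the declarations, for every number of
agents and of resources, to a matching that is feasible for the declarations. -/
structure Mechanism where
  run : ∀ {n m : ℕ}, Instance n m → Profile n m → Finset (Fin n × Fin m)
  feasible : ∀ {n m : ℕ} (I : Instance n m) (D : Profile n m), IsFeasible D (run I D)

namespace Mechanism

/-- Strategyproofness, with private graph `E`: declaring `E i` is a dominant strategy of `i`. -/
def IsStrategyproof (A : Mechanism) : Prop :=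
  ∀ (n m : ℕ) (I : Instance n m) (E D : Profile n m) (i : Fin n) (D'i : Finset (Fin m)),
    I.utility (E i) (A.run I (Function.update D i D'i)) i ≤
      I.utility (E i) (A.run I (Function.update D i (E i))) i

/-- Group-strategyproofness, with private graph `E`: for every nonempty group `S` and all
declarations `D` of the others, no joint misreport `D'` of `S` makes every member of `S` strictly
better off than truth-telling. The profile `S.piecewise E D` is `E` on `S` and `D` off `S`. -/
def IsGroupStrategyproof (A : Mechanism) : Prop :=
  ∀ (n m : ℕ) (I : Instance n m) (E D : Profile n m) (S : Finset (Fin n)), S.Nonempty →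
    ∀ D' : Profile n m, ∃ i ∈ S,
      I.utility (E i) (A.run I (S.piecewise D' D)) i ≤
        I.utility (E i) (A.run I (S.piecewise E D)) i

/-- `α`-consistency: the guarantee for perfect predictions. -/
def IsConsistent (A : Mechanism) (α : ℝ) : Prop :=
  ∀ (n m : ℕ) (I : Instance n m) (D : Profile n m),
    I.value (I.pred ∩ D.edges) = I.optValue D → I.optValue D ≤ α * I.value (A.run I D)

/-- `β`-robustness: the guarantee for arbitrary predictions. -/
def IsRobust (A : Mechanism) (β : ℝ) : Prop :=
  ∀ (n m : ℕ) (I : Instance n m) (D : Profile n m), I.optValue D ≤ β * I.value (A.run I D)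

/-- The approximation guarantee `a` on the class of instances with prediction error at most
`etaHat`. -/
def IsApproximate (A : Mechanism) (etaHat a : ℝ) : Prop :=
  ∀ (n m : ℕ) (I : Instance n m) (D : Profile n m),
    I.predError D ≤ etaHat → I.optValue D ≤ a * I.value (A.run I D)

end Mechanism

/-! ### The mechanism Boost -/

/-- Strict priorities that break ties: `agent i` ranks the resources for agent `i`, `resource j`
ranks the agents for resource `j`; higher numbers come first. -/
structure TieBreaking (n m : ℕ) where
  agent : Fin n → Fin m → ℕ
  agent_inj : ∀ i, Function.Injective (agent i)
  resource : Fin m → Fin n → ℕ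
  resource_inj : ∀ j, Function.Injective (resource j)

/-- Fixed tie-breaking rules: they may depend on the public data, but not on the declarations. -/
abbrev TieBreakingRule := ∀ n m : ℕ, Instance n m → TieBreaking n m

/-- The (boosted) offer of agent `i` to resource `j`. -/
noncomputable def offer {n m : ℕ} (I : Instance n m) (γ : ℝ) (i : Fin n) (j : Fin m) : ℝ :=
  if (i, j) ∈ I.pred then γ * I.v i j else I.v i j

/-- The key by which agent `i` orders the resources: the value `v i j`, then the tie-breaking. -/
def agentKey {n m : ℕ} (I : Instance n m) (t : TieBreaking n m) (i : Fin n) (j : Fin m) :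
    ℝ ×ₗ ℕ :=
  toLex (I.v i j, t.agent i j)

/-- The key by which resource `j` orders the agents: the offer, then the tie-breaking. -/
noncomputable def resourceKey {n m : ℕ} (I : Instance n m) (γ : ℝ) (t : TieBreaking n m)
    (j : Fin m) (i : Fin n) : ℝ ×ₗ ℕ :=
  toLex (offer I γ i j, t.resource j i)

/-- A state of the execution: the tentative matching, given by the current mate of each resource
(if any), and the remaining proposals of each agent. -/
structure State (n m : ℕ) where
  mate : Fin m → Option (Fin n)
  proposals : Fin n → Finset (Fin m)

namespace State

variable {n m : ℕ}

/-- The initial state: the matching is empty and every agent has all its declared edges left. -/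
def init (D : Profile n m) : State n m := ⟨fun _ => none, D⟩

/-- The active agents: those not tentatively matched that have some remaining proposal. -/
def active (s : State n m) : Finset (Fin n) :=
  Finset.univ.filter fun i => (∀ j, s.mate j ≠ some i) ∧ (s.proposals i).Nonempty

/-- The edges of the tentative matching. -/
def edges (s : State n m) : Finset (Fin n × Fin m) :=
  Finset.univ.filter fun e => s.mate e.2 = some e.1

theorem proposals_nonempty {s : State n m} {i : Fin n} (hi : i ∈ s.active) :
    (s.proposals i).Nonempty :=
  (Finset.mem_filter.1 hi).2.2

/-- The remaining proposal of the active agent `i` that comes first in the order of `i`. -/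
noncomputable def next (I : Instance n m) (t : TieBreaking n m) (s : State n m) {i : Fin n}
    (hi : i ∈ s.active) : Fin m :=
  (Finset.exists_max_image (s.proposals i) (agentKey I t i) (proposals_nonempty hi)).choose

theorem next_mem (I : Instance n m) (t : TieBreaking n m) (s : State n m) {i : Fin n}
    (hi : i ∈ s.active) : s.next I t hi ∈ s.proposals i :=
  (Finset.exists_max_image (s.proposals i) (agentKey I t i)
    (proposals_nonempty hi)).choose_spec.1

/-- Resource `j` accepts the offer of agent `i`: if `j` is unmatched, the offer has to exceed `0`,
otherwise it has to beat the offer of the current mate. -/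
def Accepts (I : Instance n m) (γ : ℝ) (t : TieBreaking n m) (s : State n m) (i : Fin n)
    (j : Fin m) : Prop :=
  match s.mate j with
  | none => 0 < offer I γ i j
  | some k => resourceKey I γ t j k < resourceKey I γ t j i

open Classical in
/-- One iteration: the active agent `i` makes an offer to the next resource `j` in its order. If
`j` accepts, `i` replaces the current mate of `j` (if any). The edge `(i, j)` is removed from the
remaining proposals of `i`. -/
noncomputable def step (I : Instance n m) (γ : ℝ) (t : TieBreaking n m) (s : State n m)
    {i : Fin n} (hi : i ∈ s.active) : State n m where
  mate :=
    if s.Accepts I γ t i (s.next I t hi) then Function.update s.mate (s.next I t hi) (some i)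
    else s.mate
  proposals := Function.update s.proposals i ((s.proposals i).erase (s.next I t hi))

theorem step_lt (I : Instance n m) (γ : ℝ) (t : TieBreaking n m) (s : State n m)
    {i : Fin n} (hi : i ∈ s.active) :
    ∑ k, ((s.step I γ t hi).proposals k).card < ∑ k, (s.proposals k).card := by
  have hlt : ((s.proposals i).erase (s.next I t hi)).card < (s.proposals i).card :=
    Finset.card_erase_lt_of_mem (s.next_mem I t hi)
  refine Finset.sum_lt_sum (fun k _ => ?_) ⟨i, Finset.mem_univ i, ?_⟩
  · by_cases hk : k = i
    · subst hk
      simpa [step] using hlt.le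
    · simp [step, hk]
  · simpa [step] using hlt

end State

/-- A rule that picks an active agent in each iteration; it may depend on all the data that the
mechanism has access to. -/
abbrev ChoiceRule :=
  ∀ n m : ℕ, Instance n m → Profile n m → (s : State n m) → s.active.Nonempty →
    {i : Fin n // i ∈ s.active}

/-- The main loop: iterate as long as there is an active agent. -/
noncomputable def boostLoop {n m : ℕ} (I : Instance n m) (γ : ℝ) (t : TieBreaking n m)
    (c : (s : State n m) → s.active.Nonempty → {i : Fin n // i ∈ s.active}) (s : State n m) :
    State n m :=
  if h : s.active.Nonempty then boostLoop I γ t c (s.step I γ t (c s h).2) else s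
termination_by ∑ k, (s.proposals k).card
decreasing_by exact s.step_lt I γ t (c s h).2

/-- The invariant that makes the output feasible. -/
structure State.Inv {n m : ℕ} (D : Profile n m) (s : State n m) : Prop where
  sub : ∀ i, s.proposals i ⊆ D i
  mem : ∀ i j, s.mate j = some i → j ∈ D i
  inj : ∀ i j k, s.mate j = some i → s.mate k = some i → j = k

theorem State.Inv.step {n m : ℕ} {D : Profile n m} {s : State n m} (hs : s.Inv D)
    (I : Instance n m) (γ : ℝ) (t : TieBreaking n m) {i : Fin n} (hi : i ∈ s.active) :
    (s.step I γ t hi).Inv D := by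
  have hun : ∀ j, s.mate j ≠ some i := (Finset.mem_filter.1 hi).2.1
  have hnx := s.next_mem I t hi
  have hupd : ∀ a b, Function.update s.mate (s.next I t hi) (some i) b = some a →
      (b = s.next I t hi ∧ a = i) ∨ (s.mate b = some a ∧ a ≠ i) := by
    intro a b hab
    by_cases hb : b = s.next I t hi
    · subst hb
      simp at hab
      exact Or.inl ⟨rfl, hab.symm⟩
    · rw [Function.update_of_ne hb] at hab
      refine Or.inr ⟨hab, ?_⟩
      rintro rfl
      exact hun b hab
  refine ⟨fun k => ?_, fun a b hab => ?_, fun a b c hab hac => ?_⟩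
  · by_cases hk : k = i
    · subst hk
      simpa [State.step] using (Finset.erase_subset _ _).trans (hs.sub k)
    · simpa [State.step, hk] using hs.sub k
  · simp only [State.step] at hab
    split_ifs at hab
    · rcases hupd a b hab with ⟨rfl, rfl⟩ | ⟨h, -⟩
      · exact hs.sub _ hnx
      · exact hs.mem a b h
    · exact hs.mem a b hab
  · simp only [State.step] at hab hac
    split_ifs at hab hac
    · rcases hupd a b hab with ⟨hb, ha⟩ | ⟨hb, ha⟩ <;>
        rcases hupd a c hac with ⟨hc, ha'⟩ | ⟨hc, ha'⟩
      · rw [hb, hc]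
      · exact absurd ha ha'
      · exact absurd ha' ha
      · exact hs.inj a b c hb hc
    · exact hs.inj a b c hab hac

theorem boostLoop_inv {n m : ℕ} {D : Profile n m} (I : Instance n m) (γ : ℝ)
    (t : TieBreaking n m)
    (c : (s : State n m) → s.active.Nonempty → {i : Fin n // i ∈ s.active}) (s : State n m)
    (hs : s.Inv D) : (boostLoop I γ t c s).Inv D := by
  rw [boostLoop]
  split_ifs with h
  · exact boostLoop_inv I γ t c _ (hs.step I γ t (c s h).2)
  · exact hs
termination_by ∑ k, (s.proposals k).card
decreasing_by exact s.step_lt I γ t (c s h).2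

/-- The mechanism Boost with confidence parameter `γ`, tie-breaking rules `τ` and rule `σ` for the
choice of the active agent. -/
noncomputable def boost (γ : ℝ) (τ : TieBreakingRule) (σ : ChoiceRule) : Mechanism where
  run {n m} I D := (boostLoop I γ (τ n m I) (σ n m I D) (State.init D)).edges
  feasible {n m} I D := by
    have h := boostLoop_inv (D := D) I γ (τ n m I) (σ n m I D) (State.init D)
      ⟨fun _ => Finset.Subset.refl _, by simp [State.init], by simp [State.init]⟩
    refine ⟨fun e he => ?_, fun i j k hj hk => ?_, fun i k j hi hk => ?_⟩
    · simp only [State.edges, Finset.mem_filter, Finset.mem_univ, true_and] at he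
      simpa [Profile.edges] using h.mem _ _ he
    · simp only [State.edges, Finset.mem_filter, Finset.mem_univ, true_and] at hj hk
      exact h.inj i j k hj hk
    · simp only [State.edges, Finset.mem_filter, Finset.mem_univ, true_and] at hi hk
      exact Option.some.inj (hi.symm.trans hk)

end BMP

/-!
Boost is agent-proposing deferred acceptance, in which the agents rank the resources by value and
the resources rank the agents by boosted offers. Its outcome is therefore stable (`boost_isStable`)
for every rule that picks the active agent, and all properties of Boost follow from this and from
the way the execution proceeds.

*Group-strategyproofness.* This is the blocking lemma of Gale and Sotomayor
(`exists_blocking_pair`): if a matching `N` that is feasible for the declarations `D` makes the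
agents of a nonempty set `B`, and no others, better off than deferred acceptance does, then `N` is
blocked by an edge of `D` whose agent is outside `B`. If every member of a coalition `S` gained by
a joint misreport, the resulting matching would be feasible for the true declarations, and `S`
would be contained in `B`. The blocking edge belongs to an agent outside `S`, who declares the same
set in both cases; so it would block the outcome of the misreport, which is stable. For the
blocking lemma there are two cases. If some agent of `B` has a mate `j` in `N` that deferred
acceptance does not assign to an agent of `B`, then `j` and its mate in deferred acceptance block
`N`. Otherwise the agents of `B` get the same resources in both matchings; the last offer by an
agent of `B` (`State.exists_last_step`) goes to a resource that has already rejected its mate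
in `N`, and the agent who is displaced by this offer blocks `N` with this resource.

*Approximation.* By stability every edge of a matching `N` can be charged to the edge of the
outcome at its agent, or at its resource at the cost of a factor (`Instance.value_le_of_charge`).
This factor is `γ` in general, and `1 / γ` for a predicted edge. Taking for `N` an optimal matching
gives robustness; taking the declared part of the prediction gives `value_pred_le`, hence
consistency and the guarantee for small prediction errors.

*Lower bound.* In `hardInstance` both agents slightly prefer resource `0`. Suppose that both
declare `{0}`. If agent `1` were matched, it would still have to get resource `0` when it declares
everything, against consistency. If agent `0` were matched, it would still have to get resource
`0` when it declares everything, against robustness. So no agent is matched, against robustness.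
-/

namespace BMP

variable {n m : ℕ}

/-! ### Edges, orders and offers -/

theorem Profile.mem_edges {D : Profile n m} {i : Fin n} {j : Fin m} :
    (i, j) ∈ D.edges ↔ j ∈ D i := by
  simp [Profile.edges]

theorem State.mem_edges {s : State n m} {i : Fin n} {j : Fin m} :
    (i, j) ∈ s.edges ↔ s.mate j = some i := by
  simp [State.edges]

theorem agentKey_injective (I : Instance n m) (t : TieBreaking n m) (i : Fin n) :
    Function.Injective (agentKey I t i) := fun _ _ h =>
  t.agent_inj i (congrArg (fun x => (ofLex x).2) h)

theorem resourceKey_injective (I : Instance n m) (γ : ℝ) (t : TieBreaking n m) (j : Fin m) :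
    Function.Injective (resourceKey I γ t j) := fun _ _ h =>
  t.resource_inj j (congrArg (fun x => (ofLex x).2) h)

theorem agentKey_lt_of_lt {I : Instance n m} {t : TieBreaking n m} {i : Fin n} {j k : Fin m}
    (h : I.v i j < I.v i k) : agentKey I t i j < agentKey I t i k :=
  Prod.Lex.toLex_lt_toLex.2 (Or.inl h)

theorem v_le_of_agentKey_le {I : Instance n m} {t : TieBreaking n m} {i : Fin n} {j k : Fin m}
    (h : agentKey I t i j ≤ agentKey I t i k) : I.v i j ≤ I.v i k :=
  le_of_not_gt fun hlt => (agentKey_lt_of_lt hlt).not_ge h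

theorem offer_le_of_resourceKey_le {I : Instance n m} {γ : ℝ} {t : TieBreaking n m} {j : Fin m}
    {i k : Fin n} (h : resourceKey I γ t j i ≤ resourceKey I γ t j k) :
    offer I γ i j ≤ offer I γ k j :=
  le_of_not_gt fun hlt =>
    (show resourceKey I γ t j k < resourceKey I γ t j i from
      Prod.Lex.toLex_lt_toLex.2 (Or.inl hlt)).not_ge h

theorem v_le_offer {I : Instance n m} {γ : ℝ} (hγ : 1 ≤ γ) (i : Fin n) (j : Fin m) :
    I.v i j ≤ offer I γ i j := by
  have := I.v_pos i j
  unfold offer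
  split_ifs
  · nlinarith
  · exact le_rfl

theorem offer_le {I : Instance n m} {γ : ℝ} (hγ : 1 ≤ γ) (i : Fin n) (j : Fin m) :
    offer I γ i j ≤ γ * I.v i j := by
  have := I.v_pos i j
  unfold offer
  split_ifs
  · exact le_rfl
  · nlinarith

theorem offer_pos {I : Instance n m} {γ : ℝ} (hγ : 1 ≤ γ) (i : Fin n) (j : Fin m) :
    0 < offer I γ i j :=
  (I.v_pos i j).trans_le (v_le_offer hγ i j)

/-! ### Executions of deferred acceptance -/

/-- One iteration of the main loop, for an arbitrary choice of the active agent. -/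
def State.StepRel (I : Instance n m) (γ : ℝ) (t : TieBreaking n m) (s s' : State n m) : Prop :=
  ∃ (i : Fin n) (hi : i ∈ s.active), s' = s.step I γ t hi

theorem boostLoop_reaches (I : Instance n m) (γ : ℝ) (t : TieBreaking n m)
    (c : (s : State n m) → s.active.Nonempty → {i : Fin n // i ∈ s.active}) (s : State n m) :
    Relation.ReflTransGen (State.StepRel I γ t) s (boostLoop I γ t c s) := by
  rw [boostLoop]
  split_ifs with h
  · exact (boostLoop_reaches I γ t c _).head ⟨_, _, rfl⟩
  · exact .refl
termination_by ∑ k, (s.proposals k).card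
decreasing_by exact s.step_lt I γ t (c s h).2

theorem boostLoop_active (I : Instance n m) (γ : ℝ) (t : TieBreaking n m)
    (c : (s : State n m) → s.active.Nonempty → {i : Fin n // i ∈ s.active}) (s : State n m) :
    (boostLoop I γ t c s).active = ∅ := by
  rw [boostLoop]
  split_ifs with h
  · exact boostLoop_active I γ t c _
  · exact Finset.not_nonempty_iff_eq_empty.1 h
termination_by ∑ k, (s.proposals k).card
decreasing_by exact s.step_lt I γ t (c s h).2

/-- The invariants of deferred acceptance: every agent works down its list in order and, while
matched, holds the last resource it made an offer to; a resource that has received an offer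
holds one at least as good ever after. -/
structure State.GreedyInv (I : Instance n m) (γ : ℝ) (t : TieBreaking n m) (D : Profile n m)
    (s : State n m) : Prop extends s.Inv D where
  held : ∀ i j, j ∈ D i → j ∉ s.proposals i →
    ∃ k, s.mate j = some k ∧ resourceKey I γ t j i ≤ resourceKey I γ t j k
  order : ∀ i j k, j ∈ s.proposals i → k ∈ D i → k ∉ s.proposals i →
    agentKey I t i j < agentKey I t i k
  offered : ∀ i j, s.mate j = some i → j ∉ s.proposals i
  last : ∀ i j k, s.mate j = some i → k ∈ D i → k ∉ s.proposals i →
    agentKey I t i j ≤ agentKey I t i k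

theorem State.greedyInv_init (I : Instance n m) (γ : ℝ) (t : TieBreaking n m)
    (D : Profile n m) : (State.init D).GreedyInv I γ t D where
  sub _ := Finset.Subset.refl _
  mem := by simp [State.init]
  inj := by simp [State.init]
  held _ _ h h' := absurd h h'
  order _ _ _ _ h h' := absurd h h'
  offered := by simp [State.init]
  last := by simp [State.init]

theorem State.next_max (I : Instance n m) (t : TieBreaking n m) (s : State n m) {i : Fin n}
    (hi : i ∈ s.active) {j : Fin m} (hj : j ∈ s.proposals i) :
    agentKey I t i j ≤ agentKey I t i (s.next I t hi) :=
  (Finset.exists_max_image (s.proposals i) (agentKey I t i)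
    (proposals_nonempty hi)).choose_spec.2 j hj

theorem State.not_mate_of_active {s : State n m} {i : Fin n} (hi : i ∈ s.active) (j : Fin m) :
    s.mate j ≠ some i :=
  (Finset.mem_filter.1 hi).2.1 j

theorem State.mem_step_proposals {I : Instance n m} {γ : ℝ} {t : TieBreaking n m}
    {s : State n m} {i : Fin n} (hi : i ∈ s.active) {k : Fin n} {j : Fin m} :
    j ∈ (s.step I γ t hi).proposals k ↔
      j ∈ s.proposals k ∧ ¬ (k = i ∧ j = s.next I t hi) := by
  by_cases hk : k = i
  · subst hk
    simp [State.step, and_comm]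
  · simp [State.step, hk]

/-- After one iteration the mate of a resource is either the active agent, whose offer it has
accepted, or unchanged. -/
theorem State.step_mate_cases {I : Instance n m} {γ : ℝ} {t : TieBreaking n m}
    {s : State n m} {i : Fin n} (hi : i ∈ s.active) (j : Fin m) :
    (j = s.next I t hi ∧ s.Accepts I γ t i j ∧ (s.step I γ t hi).mate j = some i) ∨
      (¬ (j = s.next I t hi ∧ s.Accepts I γ t i j) ∧
        (s.step I γ t hi).mate j = s.mate j) := by
  by_cases ha : s.Accepts I γ t i (s.next I t hi)
  · by_cases hj : j = s.next I t hi
    · subst hj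
      exact Or.inl ⟨rfl, ha, by simp [State.step, ha]⟩
    · exact Or.inr ⟨fun h => hj h.1, by simp [State.step, ha, hj]⟩
  · refine Or.inr ⟨?_, by simp [State.step, ha]⟩
    rintro ⟨rfl, h⟩
    exact ha h

theorem State.step_mate_eq_or {I : Instance n m} {γ : ℝ} {t : TieBreaking n m}
    {s : State n m} {i : Fin n} (hi : i ∈ s.active) {j : Fin m} {k : Fin n}
    (h : (s.step I γ t hi).mate j = some k) :
    (k = i ∧ j = s.next I t hi) ∨ s.mate j = some k := by
  rcases s.step_mate_cases (γ := γ) (t := t) (I := I) hi j with ⟨h1, -, h2⟩ | ⟨-, h2⟩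
  · exact Or.inl ⟨Option.some.inj (h.symm.trans h2), h1⟩
  · exact Or.inr (h2 ▸ h)

theorem State.GreedyInv.step {I : Instance n m} {γ : ℝ} (hγ : 1 ≤ γ) {t : TieBreaking n m}
    {D : Profile n m} {s : State n m} (hs : s.GreedyInv I γ t D) {i : Fin n}
    (hi : i ∈ s.active) : (s.step I γ t hi).GreedyInv I γ t D where
  toInv := hs.toInv.step I γ t hi
  held a j hj hja := by
    rw [mem_step_proposals, not_and_not_right] at hja
    -- the mate before the iteration is no better than the mate after it
    have up : ∀ k, s.mate j = some k → ∃ k', (s.step I γ t hi).mate j = some k' ∧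
        resourceKey I γ t j k ≤ resourceKey I γ t j k' := by
      intro k hk
      rcases s.step_mate_cases (γ := γ) (t := t) (I := I) hi j with ⟨-, h1, h2⟩ | ⟨-, h2⟩
      · simp only [Accepts, hk] at h1
        exact ⟨i, h2, h1.le⟩
      · exact ⟨k, h2.trans hk, le_rfl⟩
    by_cases hja' : j ∈ s.proposals a
    · obtain ⟨rfl, hjn⟩ := hja hja'
      rcases s.step_mate_cases (γ := γ) (t := t) (I := I) hi j with ⟨-, -, h2⟩ | ⟨h1, -⟩
      · exact ⟨a, h2, le_rfl⟩
      · have hna : ¬ s.Accepts I γ t a j := fun h => h1 ⟨hjn, h⟩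
        cases hk : s.mate j with
        | none => exact absurd (by simpa only [Accepts, hk] using offer_pos hγ a j) hna
        | some k =>
          simp only [Accepts, hk, not_lt] at hna
          obtain ⟨k', h, h'⟩ := up k hk
          exact ⟨k', h, hna.trans h'⟩
    · obtain ⟨k, hk, hle⟩ := hs.held a j hj hja'
      obtain ⟨k', h, h'⟩ := up k hk
      exact ⟨k', h, hle.trans h'⟩
  order a j k hj hk hka := by
    rw [mem_step_proposals] at hj
    rw [mem_step_proposals, not_and_not_right] at hka
    by_cases hka' : k ∈ s.proposals a
    · obtain ⟨rfl, rfl⟩ := hka hka'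
      refine lt_of_le_of_ne (s.next_max I t hi hj.1) fun h => hj.2 ⟨rfl, ?_⟩
      exact agentKey_injective I t a h
    · exact hs.order a j k hj.1 hk hka'
  offered a j h := by
    rw [mem_step_proposals]
    rintro ⟨h1, h2⟩
    rcases step_mate_eq_or hi h with h3 | h3
    · exact h2 h3
    · exact hs.offered a j h3 h1
  last a j k h hk hka := by
    rw [mem_step_proposals, not_and_not_right] at hka
    rcases step_mate_eq_or hi h with ⟨rfl, rfl⟩ | h3
    · by_cases hka' : k ∈ s.proposals a
      · exact (congrArg _ (hka hka').2.symm).le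
      · exact (hs.order a _ k (s.next_mem I t hi) hk hka').le
    · by_cases hka' : k ∈ s.proposals a
      · obtain ⟨rfl, -⟩ := hka hka'
        exact absurd h3 (not_mate_of_active hi j)
      · exact hs.last a j k h3 hk hka'

theorem State.GreedyInv.reaches {I : Instance n m} {γ : ℝ} (hγ : 1 ≤ γ) {t : TieBreaking n m}
    {D : Profile n m} {s s' : State n m} (hs : s.GreedyInv I γ t D)
    (h : Relation.ReflTransGen (State.StepRel I γ t) s s') : s'.GreedyInv I γ t D := by
  induction h with
  | refl => exact hs
  | tail _ h ih =>
    obtain ⟨i, hi, rfl⟩ := h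
    exact ih.step hγ hi

/-- The final mate of an agent is its present mate, or a resource still on its list. -/
theorem State.mate_of_reaches {I : Instance n m} {γ : ℝ} {t : TieBreaking n m}
    {s s' : State n m} (h : Relation.ReflTransGen (State.StepRel I γ t) s s') {i : Fin n}
    {j : Fin m} (hj : s'.mate j = some i) : s.mate j = some i ∨ j ∈ s.proposals i := by
  induction h using Relation.ReflTransGen.head_induction_on with
  | refl => exact Or.inl hj
  | head h _ ih =>
    obtain ⟨a, ha, rfl⟩ := h
    rcases ih with h | h
    · rcases step_mate_eq_or ha h with ⟨rfl, rfl⟩ | h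
      · exact Or.inr (State.next_mem _ _ _ _)
      · exact Or.inl h
    · exact Or.inr ((mem_step_proposals ha).1 h).1

/-! ### Stability -/

/-- No declared edge blocks `M`: at one of its ends, `M` has an edge that this end ranks at least
as high. -/
def IsStable (I : Instance n m) (γ : ℝ) (t : TieBreaking n m) (D : Profile n m)
    (M : Finset (Fin n × Fin m)) : Prop :=
  ∀ i, ∀ j ∈ D i, (∃ k, (i, k) ∈ M ∧ agentKey I t i j ≤ agentKey I t i k) ∨
    ∃ k, (k, j) ∈ M ∧ resourceKey I γ t j i ≤ resourceKey I γ t j k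

theorem State.GreedyInv.isStable {I : Instance n m} {γ : ℝ} {t : TieBreaking n m}
    {D : Profile n m} {s : State n m} (hs : s.GreedyInv I γ t D) (ha : s.active = ∅) :
    IsStable I γ t D s.edges := by
  intro i j hj
  by_cases hp : j ∈ s.proposals i
  · left
    have : i ∉ s.active := by simp [ha]
    simp only [State.active, Finset.mem_filter, Finset.mem_univ, true_and, not_and,
      Finset.not_nonempty_iff_eq_empty] at this
    obtain ⟨k, hk⟩ : ∃ k, s.mate k = some i := by
      by_contra! h
      simp [this h] at hp
    exact ⟨k, mem_edges.2 hk, (hs.order i j k hp (hs.mem i k hk) (hs.offered i k hk)).le⟩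
  · right
    obtain ⟨k, hk, h⟩ := hs.held i j hj hp
    exact ⟨k, mem_edges.2 hk, h⟩

theorem boost_isStable {γ : ℝ} (hγ : 1 ≤ γ) (τ : TieBreakingRule) (σ : ChoiceRule)
    (I : Instance n m) (D : Profile n m) :
    IsStable I γ (τ n m I) D ((boost γ τ σ).run I D) :=
  ((State.greedyInv_init I γ _ D).reaches hγ (boostLoop_reaches I γ _ _ _)).isStable
    (boostLoop_active I γ _ _ _)

/-! ### Group-strategyproofness -/

/-- If every agent of `B` is matched at the end of the execution, but not in the state `s`, then
there is a last iteration before which some agent of `B` is unmatched. From then on, all agents of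
`B` keep their mates. -/
theorem State.exists_last_step {I : Instance n m} {γ : ℝ} {t : TieBreaking n m}
    {D : Profile n m} {s f : State n m} (hs : s.Inv D)
    (h : Relation.ReflTransGen (State.StepRel I γ t) s f) {B : Finset (Fin n)}
    (hB : ∀ i ∈ B, ∃ j, f.mate j = some i) (hsB : ∃ i ∈ B, ∀ j, s.mate j ≠ some i) :
    ∃ s', Relation.ReflTransGen (State.StepRel I γ t) s s' ∧
      ∃ (i : Fin n) (hi : i ∈ s'.active), i ∈ B ∧
        Relation.ReflTransGen (State.StepRel I γ t) (s'.step I γ t hi) f ∧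
        ∀ k ∈ B, ∀ j, f.mate j = some k → (s'.step I γ t hi).mate j = some k := by
  suffices (∀ k ∈ B, ∀ j, f.mate j = some k → s.mate j = some k) ∨
      ∃ s', Relation.ReflTransGen (State.StepRel I γ t) s s' ∧
      ∃ (i : Fin n) (hi : i ∈ s'.active), i ∈ B ∧
        Relation.ReflTransGen (State.StepRel I γ t) (s'.step I γ t hi) f ∧
        ∀ k ∈ B, ∀ j, f.mate j = some k → (s'.step I γ t hi).mate j = some k by
    refine this.resolve_left fun h' => ?_
    obtain ⟨i, hi, hun⟩ := hsB
    obtain ⟨j, hj⟩ := hB i hi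
    exact hun j (h' i hi j hj)
  clear hsB
  induction h using Relation.ReflTransGen.head_induction_on with
  | refl => exact Or.inl fun _ _ _ h => h
  | @head s s'' h hf ih =>
    obtain ⟨a, ha, rfl⟩ := h
    rcases ih (hs.step I γ t ha) with h1 | ⟨s', hr, hs'⟩
    · by_cases haB : a ∈ B
      · exact Or.inr ⟨s, .refl, a, ha, haB, hf, h1⟩
      · refine Or.inl fun k hk j hj => ?_
        rcases step_mate_eq_or ha (h1 k hk j hj) with ⟨rfl, -⟩ | h2
        · exact absurd hk haB
        · exact h2
    · exact Or.inr ⟨s', hr.head ⟨a, ha, rfl⟩, hs'⟩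

/-- The blocking lemma. `f` is the final state of an execution, and `B` is the set of the agents
that prefer the feasible matching `N` to it. Then `N` is blocked by a declared edge whose agent is
outside `B`. -/
theorem exists_blocking_pair {I : Instance n m} {γ : ℝ} (hγ : 1 ≤ γ) {t : TieBreaking n m}
    {D : Profile n m} {f : State n m}
    (hf : Relation.ReflTransGen (State.StepRel I γ t) (State.init D) f) (ha : f.active = ∅)
    {N : Finset (Fin n × Fin m)} (hN : IsFeasible D N) {B : Finset (Fin n)} (hB : B.Nonempty)
    (hBN : ∀ i, i ∈ B ↔ ∃ j, (i, j) ∈ N ∧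
      ∀ k, f.mate k = some i → agentKey I t i k < agentKey I t i j) :
    ∃ i j, i ∉ B ∧ j ∈ D i ∧ (∀ k, (i, k) ∈ N → agentKey I t i k < agentKey I t i j) ∧
      ∀ k, (k, j) ∈ N → resourceKey I γ t j k < resourceKey I γ t j i := by
  have h0 := State.greedyInv_init I γ t D
  have hI := h0.reaches hγ hf
  have hND : ∀ i j, (i, j) ∈ N → j ∈ D i := fun i j h => Profile.mem_edges.1 (hN.subset h)
  -- an agent outside `B` ranks its edge of `N` no higher than its final mate (if any), and hence
  -- no higher than any resource `k` that is at least as good as this mate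
  have hout : ∀ i ∉ B, ∀ j k, (i, j) ∈ N → (∀ l, f.mate l = some i → agentKey I t i l ≤
      agentKey I t i k) → agentKey I t i j ≤ agentKey I t i k := by
    intro i hi j k hj hl
    by_contra! hlt
    exact hi ((hBN i).2 ⟨j, hj, fun l hfl => (hl l hfl).trans_lt hlt⟩)
  -- an agent of `B` strictly prefers its edge of `N`
  have hin : ∀ i ∈ B, ∀ j, (i, j) ∈ N →
      ∀ k, f.mate k = some i → agentKey I t i k < agentKey I t i j := by
    intro i hi j hj
    obtain ⟨j', hj', h⟩ := (hBN i).1 hi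
    rwa [hN.agent i j j' hj hj']
  by_cases hcase : ∀ i ∈ B, ∀ j, (i, j) ∈ N → ∃ k ∈ B, f.mate j = some k
  · -- `N` and the final matching match `B` to the same resources
    have hex : ∀ i : B, ∃ k : B, ∃ j, ((i : Fin n), j) ∈ N ∧ f.mate j = some (k : Fin n) := by
      rintro ⟨i, hi⟩
      obtain ⟨j, hj, -⟩ := (hBN i).1 hi
      obtain ⟨k, hk, hjk⟩ := hcase i hi j hj
      exact ⟨⟨k, hk⟩, j, hj, hjk⟩
    choose g r hgN hgf using hex
    have hg : Function.Injective g := by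
      intro i i' h
      have h1 := hgf i
      rw [h] at h1
      have h2 := hgN i
      rw [hI.inj _ _ _ h1 (hgf i')] at h2
      exact Subtype.ext (hN.resource _ _ _ h2 (hgN i'))
    have hsurj : ∀ k ∈ B, ∃ i ∈ B, ∃ j, (i, j) ∈ N ∧ f.mate j = some k := by
      intro k hk
      obtain ⟨i, hi⟩ := Finite.surjective_of_injective hg ⟨k, hk⟩
      refine ⟨i, i.2, r i, hgN i, ?_⟩
      rw [hgf i, hi]
    obtain ⟨b, hb⟩ := hB
    obtain ⟨s, hs, i, hi, hiB, hsf, hlast⟩ := State.exists_last_step h0.toInv hf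
      (fun k hk => let ⟨_, _, j, _, h⟩ := hsurj k hk; ⟨j, h⟩)
      ⟨b, hb, by simp [State.init]⟩
    have hsI := h0.reaches hγ hs
    have hsI' := hsI.step hγ hi
    -- the last agent `i` of `B` to make an offer makes it to `j`, the mate of `a ∈ B` in `N`
    obtain ⟨a, haB, j, haj, hij⟩ := hsurj i hiB
    have hij' := hlast i hiB j hij
    have hjn : j = s.next I t hi := by
      rcases State.step_mate_eq_or hi hij' with h | h
      · exact h.2
      · exact absurd h (State.not_mate_of_active hi j)
    have hai : a ≠ i := by
      rintro rfl
      exact lt_irrefl _ (hin a haB j haj j hij)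
    -- by then `a` has made its offer to `j`
    obtain ⟨_, _, l, -, hal⟩ := hsurj a haB
    have hja' : j ∉ (s.step I γ t hi).proposals a := fun h =>
      ((hsI'.order a j l h (hsI'.mem a l (hlast a haB l hal))
        (hsI'.offered a l (hlast a haB l hal))).trans (hin a haB j haj l hal)).false
    have hja : j ∉ s.proposals a := fun h =>
      hja' ((State.mem_step_proposals hi).2 ⟨h, fun h' => hai h'.1⟩)
    obtain ⟨k, hk, hak⟩ := hsI.held a j (hND a j haj) hja
    have hki : k ≠ i := by
      rintro rfl
      exact State.not_mate_of_active hi j hk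
    -- so `i` displaces a mate `k` of `j`, and `k` is unmatched after this iteration
    have hkun : ∀ l, (s.step I γ t hi).mate l ≠ some k := by
      intro l hl
      rcases State.step_mate_eq_or hi hl with h | h
      · exact hki h.1
      · obtain rfl := hsI.inj _ _ _ h hk
        exact hki (Option.some.inj (hl.symm.trans hij'))
    have hkB : k ∉ B := by
      intro h
      obtain ⟨_, _, l, -, hl⟩ := hsurj k h
      exact hkun l (hlast k h l hl)
    have hkD : j ∈ D k := hsI.mem k j hk
    have hka : k ≠ a := fun h => hkB (h ▸ haB)
    refine ⟨k, j, hkB, hkD, fun l hl => ?_, fun b hb => ?_⟩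
    · refine lt_of_le_of_ne (hout k hkB l j hl fun l' hl' => ?_) fun h => ?_
      · have hp := (State.mate_of_reaches hsf hl').resolve_left (hkun l')
        refine (hsI'.order k l' j hp hkD fun h => ?_).le
        exact hsI.offered k j hk ((State.mem_step_proposals hi).1 h).1
      · rw [agentKey_injective I t k h] at hl
        exact hka (hN.resource _ _ _ hl haj)
    · obtain rfl := hN.resource _ _ _ hb haj
      exact lt_of_le_of_ne hak fun h => hka (resourceKey_injective I γ t j h).symm
  · push Not at hcase
    obtain ⟨i, hi, j, hij, hj⟩ := hcase
    obtain ⟨k, hk, h⟩ | ⟨k, hk, h⟩ := hI.isStable ha i j (hND i j hij)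
    · exact absurd h (hin i hi j hij k (State.mem_edges.1 hk)).not_ge
    rw [State.mem_edges] at hk
    have hkB : k ∉ B := fun h => hj k h hk
    have hki : k ≠ i := fun h => hkB (h ▸ hi)
    refine ⟨k, j, hkB, hI.mem k j hk, fun l hl => ?_, fun b hb => ?_⟩
    · refine lt_of_le_of_ne (hout k hkB l j hl fun l' hl' => ?_) fun h => ?_
      · rw [hI.inj _ _ _ hl' hk]
      · rw [agentKey_injective I t k h] at hl
        exact hki (hN.resource _ _ _ hl hij)
    · obtain rfl := hN.resource _ _ _ hb hij
      exact lt_of_le_of_ne h fun h => hki (resourceKey_injective I γ t j h).symm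

theorem Instance.utility_nonneg (I : Instance n m) (Ei : Finset (Fin m))
    (M : Finset (Fin n × Fin m)) (i : Fin n) : 0 ≤ I.utility Ei M i :=
  Finset.sum_nonneg fun j _ => (I.v_pos i j).le

/-- The utility of an agent with a truly compatible mate is the value of that edge. -/
theorem Instance.utility_eq {I : Instance n m} {D : Profile n m} {M : Finset (Fin n × Fin m)}
    (hM : IsFeasible D M) {Ei : Finset (Fin m)} {i : Fin n} {j : Fin m} (hij : (i, j) ∈ M)
    (hj : j ∈ Ei) : I.utility Ei M i = I.v i j := by
  have : Ei.filter (fun k => (i, k) ∈ M) = {j} := by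
    ext k
    simp only [Finset.mem_filter, Finset.mem_singleton]
    exact ⟨fun h => hM.agent i k j h.2 hij, by rintro rfl; exact ⟨hj, hij⟩⟩
  simp [Instance.utility, this]

theorem Instance.exists_edge_of_utility_pos {I : Instance n m} {Ei : Finset (Fin m)}
    {M : Finset (Fin n × Fin m)} {i : Fin n} (h : 0 < I.utility Ei M i) :
    ∃ j ∈ Ei, (i, j) ∈ M := by
  by_contra! hno
  refine h.ne' (Finset.sum_eq_zero fun j hj => ?_)
  rw [Finset.mem_filter] at hj
  exact absurd hj.2 (hno j hj.1)

theorem boost_isGroupStrategyproof {γ : ℝ} (hγ : 1 ≤ γ) (τ : TieBreakingRule)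
    (σ : ChoiceRule) : (boost γ τ σ).IsGroupStrategyproof := by
  intro n m I E D S hS D'
  by_contra! hlt
  set t := τ n m I
  set T : Profile n m := S.piecewise E D
  set F : Profile n m := S.piecewise D' D
  set f := boostLoop I γ t (σ n m I T) (State.init T) with hfdef
  set N := (boost γ τ σ).run I F with hNdef
  have hNF : IsFeasible F N := (boost γ τ σ).feasible I F
  have hfT : IsFeasible T f.edges := (boost γ τ σ).feasible I T
  have hrun : (boost γ τ σ).run I T = f.edges := rfl
  rw [hrun] at hlt
  -- the members of `S` are truly compatible with their mates in `N`, and prefer them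
  have hgain : ∀ i ∈ S, ∃ j ∈ E i, (i, j) ∈ N ∧
      ∀ k, f.mate k = some i → agentKey I t i k < agentKey I t i j := by
    intro i hi
    obtain ⟨j, hj, hij⟩ := Instance.exists_edge_of_utility_pos
      ((I.utility_nonneg (E i) f.edges i).trans_lt (hlt i hi))
    refine ⟨j, hj, hij, fun k hk => agentKey_lt_of_lt ?_⟩
    have hkE : k ∈ E i := by
      have := Profile.mem_edges.1 (hfT.subset (State.mem_edges.2 hk))
      simpa [T, hi] using this
    have := hlt i hi
    rwa [Instance.utility_eq hNF hij hj,
      Instance.utility_eq hfT (State.mem_edges.2 hk) hkE] at this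
  have hNT : IsFeasible T N := by
    refine ⟨?_, hNF.agent, hNF.resource⟩
    rintro ⟨i, j⟩ hij
    rw [Profile.mem_edges]
    by_cases hi : i ∈ S
    · obtain ⟨k, hk, hik, -⟩ := hgain i hi
      rw [hNF.agent i j k hij hik]
      simpa [T, hi] using hk
    · have := Profile.mem_edges.1 (hNF.subset hij)
      simpa [T, F, hi] using this
  classical
  obtain ⟨i, j, hi, hj, h1, h2⟩ := exists_blocking_pair hγ
    (boostLoop_reaches I γ t (σ n m I T) (State.init T)) (boostLoop_active I γ t _ _) hNT
    (B := Finset.univ.filter fun i => ∃ j, (i, j) ∈ N ∧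
      ∀ k, f.mate k = some i → agentKey I t i k < agentKey I t i j)
    (by
      obtain ⟨i, hi⟩ := hS
      obtain ⟨j, -, h⟩ := hgain i hi
      exact ⟨i, by simpa using ⟨j, h⟩⟩)
    (fun i => by simp [hfdef])
  have hiS : i ∉ S := fun h => hi (by
    obtain ⟨j, -, h⟩ := hgain i h
    simpa using ⟨j, h⟩)
  have hjF : j ∈ F i := by simpa [T, F, hiS] using hj
  obtain ⟨k, hk, h⟩ | ⟨k, hk, h⟩ := boost_isStable hγ τ σ I F i j hjF
  · exact (h1 k hk).not_ge h
  · exact (h2 k hk).not_ge h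

/-! ### Approximation guarantees -/

theorem Instance.value_nonneg (I : Instance n m) (M : Finset (Fin n × Fin m)) : 0 ≤ I.value M :=
  Finset.sum_nonneg fun e _ => (I.v_pos e.1 e.2).le

theorem Instance.value_le_optValue {I : Instance n m} {D : Profile n m}
    {M : Finset (Fin n × Fin m)} (hM : IsFeasible D M) : I.value M ≤ I.optValue D := by
  classical
  exact Finset.le_sup' I.value (Finset.mem_filter.2 ⟨Finset.mem_univ _, hM⟩)

theorem Instance.optValue_le {I : Instance n m} {D : Profile n m} {x : ℝ}
    (h : ∀ M, IsFeasible D M → I.value M ≤ x) : I.optValue D ≤ x := by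
  classical
  exact Finset.sup'_le _ _ fun M hM => h M (Finset.mem_filter.1 hM).2

/-- The edges of `M` over pairwise distinct points `p e`, `e ∈ N`, have total value at most that
of `M`. -/
theorem Instance.sum_fiber_le (I : Instance n m) {α : Type*} [DecidableEq α] [Fintype α]
    (M N : Finset (Fin n × Fin m)) (p : Fin n × Fin m → α) (hp : Set.InjOn p N) :
    ∑ e ∈ N, I.value (M.filter fun x => p x = p e) ≤ I.value M := by
  rw [← Finset.sum_image (f := fun a => I.value (M.filter fun x => p x = a)) hp]
  refine (Finset.sum_le_univ_sum_of_nonneg fun a => I.value_nonneg _).trans_eq ?_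
  exact Finset.sum_fiberwise M p fun e => I.v e.1 e.2

/-- Charging argument: every edge of the matching `N` is charged to the edge of `M` at its agent
or, with a factor `c`, to the edge of `M` at its resource. -/
theorem Instance.value_le_of_charge (I : Instance n m) {M N : Finset (Fin n × Fin m)}
    (hagent : ∀ i j k, (i, j) ∈ N → (i, k) ∈ N → j = k)
    (hresource : ∀ i k j, (i, j) ∈ N → (k, j) ∈ N → i = k) {c : ℝ} (hc : 0 ≤ c)
    (h : ∀ i j, (i, j) ∈ N → (∃ k, (i, k) ∈ M ∧ I.v i j ≤ I.v i k) ∨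
      ∃ k, (k, j) ∈ M ∧ I.v i j ≤ c * I.v k j) :
    I.value N ≤ (1 + c) * I.value M := by
  have single : ∀ (p : Fin n × Fin m → Prop) [DecidablePred p], ∀ e ∈ M, p e →
      I.v e.1 e.2 ≤ I.value (M.filter p) := fun p _ e he hpe =>
    Finset.single_le_sum (f := fun e => I.v e.1 e.2) (fun x _ => (I.v_pos x.1 x.2).le)
      (Finset.mem_filter.2 ⟨he, hpe⟩)
  have hle : I.value N ≤ ∑ e ∈ N, (I.value (M.filter fun x => x.1 = e.1) +
      c * I.value (M.filter fun x => x.2 = e.2)) := by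
    refine Finset.sum_le_sum ?_
    rintro ⟨i, j⟩ hij
    have h1 := I.value_nonneg (M.filter fun x => x.1 = i)
    have h2 := mul_nonneg hc (I.value_nonneg (M.filter fun x => x.2 = j))
    rcases h i j hij with ⟨k, hk, hle⟩ | ⟨k, hk, hle⟩
    · have := single (fun x => x.1 = i) (i, k) hk rfl
      dsimp only at this ⊢
      linarith
    · have := mul_le_mul_of_nonneg_left (single (fun x => x.2 = j) (k, j) hk rfl) hc
      dsimp only at this ⊢
      linarith
  rw [Finset.sum_add_distrib, ← Finset.mul_sum] at hle
  have h1 := I.sum_fiber_le M N Prod.fst (by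
    rintro ⟨i, j⟩ hj ⟨i', k⟩ hk (rfl : i = i')
    rw [hagent i j k hj hk])
  have h2 := mul_le_mul_of_nonneg_left (I.sum_fiber_le M N Prod.snd (by
    rintro ⟨i, j⟩ hj ⟨k, j'⟩ hk (rfl : j = j')
    rw [hresource i k j hj hk])) hc
  linarith

theorem boost_isRobust {γ : ℝ} (hγ : 1 ≤ γ) (τ : TieBreakingRule) (σ : ChoiceRule) :
    (boost γ τ σ).IsRobust (1 + γ) := by
  intro n m I D
  refine Instance.optValue_le fun N hN => ?_
  refine I.value_le_of_charge hN.agent hN.resource (zero_le_one.trans hγ) fun i j hij => ?_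
  rcases boost_isStable hγ τ σ I D i j (Profile.mem_edges.1 (hN.subset hij)) with
    ⟨k, hk, h⟩ | ⟨k, hk, h⟩
  · exact Or.inl ⟨k, hk, v_le_of_agentKey_le h⟩
  · exact Or.inr ⟨k, hk, (v_le_offer hγ i j).trans
      ((offer_le_of_resourceKey_le h).trans (offer_le hγ k j))⟩

/-- Boost recovers the declared part of the prediction up to the factor `1 + 1 / γ`: a predicted
edge makes a boosted offer, so only an agent with an offer `γ` times as valuable displaces it. -/
theorem value_pred_le {γ : ℝ} (hγ : 1 ≤ γ) (τ : TieBreakingRule) (σ : ChoiceRule)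
    (I : Instance n m) (D : Profile n m) :
    I.value (I.pred ∩ D.edges) ≤ (1 + 1 / γ) * I.value ((boost γ τ σ).run I D) := by
  have hγ0 : 0 < γ := zero_lt_one.trans_le hγ
  refine I.value_le_of_charge
    (fun i j k hj hk => I.pred_agent i j k (Finset.mem_inter.1 hj).1 (Finset.mem_inter.1 hk).1)
    (fun i k j hi hk =>
      I.pred_resource i k j (Finset.mem_inter.1 hi).1 (Finset.mem_inter.1 hk).1)
    (by positivity) fun i j hij => ?_
  obtain ⟨hpred, hD⟩ := Finset.mem_inter.1 hij
  rcases boost_isStable hγ τ σ I D i j (Profile.mem_edges.1 hD) with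
    ⟨k, hk, h⟩ | ⟨k, hk, h⟩
  · exact Or.inl ⟨k, hk, v_le_of_agentKey_le h⟩
  · by_cases hki : k = i
    · subst hki
      exact Or.inl ⟨j, hk, le_rfl⟩
    · have hkpred : (k, j) ∉ I.pred := fun h' => hki (I.pred_resource k i j h' hpred)
      have h' := offer_le_of_resourceKey_le h
      rw [offer, if_pos hpred, offer, if_neg hkpred] at h'
      refine Or.inr ⟨k, hk, ?_⟩
      rw [one_div, ← div_eq_inv_mul, le_div_iff₀ hγ0]
      linarith

theorem boost_isConsistent {γ : ℝ} (hγ : 1 ≤ γ) (τ : TieBreakingRule) (σ : ChoiceRule) :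
    (boost γ τ σ).IsConsistent (1 + 1 / γ) := fun _ _ I D h =>
  h ▸ value_pred_le hγ τ σ I D

theorem boost_isApproximate {γ : ℝ} (hγ : 1 ≤ γ) (τ : TieBreakingRule) (σ : ChoiceRule)
    (etaHat : ℝ) : (boost γ τ σ).IsApproximate etaHat
      (if etaHat ≤ 1 - 1 / γ then (1 + γ) / (γ * (1 - etaHat)) else 1 + γ) := by
  intro n m I D herr
  split_ifs with hη
  · have hγ0 : 0 < γ := zero_lt_one.trans_le hγ
    have hη1 : 0 < 1 - etaHat := by
      have : 0 < 1 / γ := by positivity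
      linarith
    have hval := I.value_nonneg ((boost γ τ σ).run I D)
    have hopt : 0 ≤ I.optValue D := by
      simpa [Instance.value] using Instance.value_le_optValue (I := I) (isFeasible_empty D)
    rw [Instance.predError] at herr
    split_ifs at herr with h0
    · rw [h0]
      positivity
    · have hpos : 0 < I.optValue D := lt_of_le_of_ne hopt (Ne.symm h0)
      have h1 : (1 - etaHat) * I.optValue D ≤ I.value (I.pred ∩ D.edges) := by
        rw [← le_div_iff₀ hpos]
        linarith
      have h2 := h1.trans (value_pred_le hγ τ σ I D)
      have h3 : (1 + γ) / (γ * (1 - etaHat)) * I.value ((boost γ τ σ).run I D) =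
          ((1 + 1 / γ) * I.value ((boost γ τ σ).run I D)) / (1 - etaHat) := by
        field_simp
        ring
      rw [h3, le_div_iff₀ hη1]
      linarith
  · exact boost_isRobust hγ τ σ n m I D

/-! ### The lower bound -/

/-- The instance of the lower bound, with two agents and two resources: the predicted edges are
`(0, 0)` of value `1` and `(1, 1)` of value `γ - (2 * γ + 2) * δ`; both agents slightly prefer
resource `0`. The coefficients of `δ` are chosen such that `(1 + v 1 1) / v 1 0 > 1 + 1 / γ`, the
ratio that consistency excludes, while `(v 0 1 + v 1 0) / v 0 0 = 1 + γ - (2 * γ + 2) * δ`, the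
ratio that robustness excludes for small `δ`. -/
noncomputable def hardInstance (γ δ : ℝ) (hδ : 0 < δ) (hγδ : (2 * γ + 2) * δ < γ)
    (hδ1 : δ < 1) : Instance 2 2 where
  v := !![1, 1 - δ; γ - (2 * γ + 1) * δ, γ - (2 * γ + 2) * δ]
  v_pos := by
    intro i j
    fin_cases i <;> fin_cases j <;> simp <;> linarith
  pred := {(0, 0), (1, 1)}
  pred_agent := by decide
  pred_resource := by decide

theorem Instance.value_eq_sum (I : Instance n m) (M : Finset (Fin n × Fin m)) :
    I.value M = ∑ i, ∑ j, if (i, j) ∈ M then I.v i j else 0 := by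
  rw [← Fintype.sum_prod_type' (f := fun i j => if (i, j) ∈ M then I.v i j else 0)]
  simp [Instance.value, Finset.sum_ite_mem]

theorem not_exists_strategyproof {γ : ℝ} (hγ : 1 ≤ γ) {ε : ℝ} (hε : 0 < ε) :
    ¬ ∃ A : Mechanism, A.IsStrategyproof ∧ A.IsConsistent (1 + 1 / γ) ∧
      A.IsRobust (1 + γ - ε) := by
  rintro ⟨A, hsp, hcons, hrob⟩
  have hγ0 : 0 < γ := zero_lt_one.trans_le hγ
  obtain ⟨δ, hδ, hδε, hγδ⟩ : ∃ δ : ℝ, 0 < δ ∧ (2 * γ + 2) * δ < ε ∧ (2 * γ + 2) * δ < γ := by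
    refine ⟨min ε γ / (4 * γ + 4), by positivity, ?_, ?_⟩
    all_goals
      have h1 : (2 * γ + 2) * (min ε γ / (4 * γ + 4)) = min ε γ / 2 := by
        field_simp
        ring
      have h2 : 0 < min ε γ := lt_min hε hγ0
      rw [h1]
    · linarith [min_le_left ε γ]
    · linarith [min_le_right ε γ]
  have hδ1 : δ < 1 := by nlinarith
  set I := hardInstance γ δ hδ hγδ hδ1 with hI
  have v00 : I.v 0 0 = 1 := by simp [hI, hardInstance]
  have v01 : I.v 0 1 = 1 - δ := by simp [hI, hardInstance]
  have v10 : I.v 1 0 = γ - (2 * γ + 1) * δ := by simp [hI, hardInstance]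
  have v11 : I.v 1 1 = γ - (2 * γ + 2) * δ := by simp [hI, hardInstance]
  have hval : ∀ M, I.value M = (if (0, 0) ∈ M then I.v 0 0 else 0) +
      (if (0, 1) ∈ M then I.v 0 1 else 0) + ((if (1, 0) ∈ M then I.v 1 0 else 0) +
      if (1, 1) ∈ M then I.v 1 1 else 0) := fun M => by
    simp only [I.value_eq_sum, Fin.sum_univ_two]
  set D : Profile 2 2 := fun _ => {0} with hD
  have hfeas := fun D' : Profile 2 2 => A.feasible I D'
  have hedge : ∀ {D' : Profile 2 2} {M} {i j}, IsFeasible D' M → j ∉ D' i → (i, j) ∉ M :=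
    fun hM hj h => hj (Profile.mem_edges.1 (hM.subset h))
  -- an agent that gets resource `0` by declaring `{0}` also gets it by declaring everything
  have hkeep : ∀ i, (i, 0) ∈ A.run I D →
      (i, 0) ∈ A.run I (Function.update D i Finset.univ) := by
    intro i hi
    have h := hsp 2 2 I (fun _ => Finset.univ) D i {0}
    rw [show Function.update D i {0} = D from Function.update_eq_self i D,
      Instance.utility_eq (hfeas D) hi (Finset.mem_univ _)] at h
    obtain ⟨j, hj, hij⟩ := Instance.exists_edge_of_utility_pos ((I.v_pos i 0).trans_le h)
    rw [Instance.utility_eq (hfeas _) hij hj] at h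
    have hlt : I.v i 1 < I.v i 0 := by
      fin_cases i
      · simp only [Fin.zero_eta, v00, v01]; linarith
      · simp only [Fin.mk_one, v10, v11]; nlinarith
    fin_cases j
    · exact hij
    · exact absurd h hlt.not_ge
  -- consistency: the prediction is perfect when agent `1` declares everything
  have h1 : (1, 0) ∉ A.run I D := by
    intro h
    have h10 := hkeep 1 h
    set D₁ : Profile 2 2 := Function.update D 1 Finset.univ with hD₁
    have hpred : I.value (I.pred ∩ D₁.edges) = I.v 0 0 + I.v 1 1 := by
      have : I.pred ∩ D₁.edges = {(0, 0), (1, 1)} := by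
        have hpr : I.pred = {(0, 0), (1, 1)} := rfl
        rw [hpr, hD₁, hD]
        decide
      rw [this]
      simp [Instance.value]
    have hperfect : I.value (I.pred ∩ D₁.edges) = I.optValue D₁ := by
      refine le_antisymm (Instance.value_le_optValue ⟨Finset.inter_subset_right, ?_, ?_⟩)
        (Instance.optValue_le fun M hM => ?_)
      · exact fun i j k hj hk =>
          I.pred_agent i j k (Finset.mem_inter.1 hj).1 (Finset.mem_inter.1 hk).1
      · exact fun i k j hi hk =>
          I.pred_resource i k j (Finset.mem_inter.1 hi).1 (Finset.mem_inter.1 hk).1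
      · have m01 : (0, 1) ∉ M := hedge hM (by simp [hD₁, hD])
        have p11 := I.v_pos 1 1
        rw [hpred, hval, if_neg m01]
        by_cases m10 : (1, 0) ∈ M
        · have m00 : (0, 0) ∉ M := fun h => absurd (hM.resource _ _ _ h m10) (by decide)
          have m11 : (1, 1) ∉ M := fun h => absurd (hM.agent _ _ _ h m10) (by decide)
          rw [if_pos m10, if_neg m00, if_neg m11, v00, v10, v11]
          linarith
        · rw [if_neg m10]
          split_ifs <;> linarith
    have h := hcons 2 2 I D₁ hperfect
    have m01 : (0, 1) ∉ A.run I D₁ := hedge (hfeas _) (by simp [hD₁, hD])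
    have m00 : (0, 0) ∉ A.run I D₁ := fun h =>
      absurd ((hfeas _).resource _ _ _ h h10) (by decide)
    have m11 : (1, 1) ∉ A.run I D₁ := fun h =>
      absurd ((hfeas _).agent _ _ _ h h10) (by decide)
    rw [← hperfect, hpred, hval, if_pos h10, if_neg m01, if_neg m00, if_neg m11, v00, v10,
      v11] at h
    have h' := mul_le_mul_of_nonneg_left h hγ0.le
    have h'' : γ * ((1 + 1 / γ) * (0 + 0 + (γ - (2 * γ + 1) * δ + 0))) =
        (γ + 1) * (γ - (2 * γ + 1) * δ) := by
      field_simp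
      ring
    rw [h''] at h'
    nlinarith
  -- robustness: when agent `0` declares everything, agent `1` has to get resource `0`
  have h0 : (0, 0) ∉ A.run I D := by
    intro h
    have h00 := hkeep 0 h
    set D₀ : Profile 2 2 := Function.update D 0 Finset.univ with hD₀
    have m01 : (0, 1) ∉ A.run I D₀ := fun h =>
      absurd ((hfeas _).agent _ _ _ h h00) (by decide)
    have m10 : (1, 0) ∉ A.run I D₀ := fun h =>
      absurd ((hfeas _).resource _ _ _ h h00) (by decide)
    have m11 : (1, 1) ∉ A.run I D₀ := hedge (hfeas _) (by simp [hD₀, hD])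
    have hopt : I.value {(0, 1), (1, 0)} ≤ I.optValue D₀ := by
      refine Instance.value_le_optValue ⟨?_, by decide, by decide⟩
      rw [hD₀, hD]
      decide
    have h := hopt.trans (hrob 2 2 I D₀)
    rw [hval, hval, if_pos h00, if_neg m01, if_neg m10, if_neg m11] at h
    simp [v00, v01, v10] at h
    linarith
  -- so both agents are unmatched when they declare `{0}`
  have hopt : I.value {(0, 0)} ≤ I.optValue D := by
    refine Instance.value_le_optValue ⟨?_, by decide, by decide⟩
    rw [hD]
    decide
  have h := hopt.trans (hrob 2 2 I D)
  have m01 : (0, 1) ∉ A.run I D := hedge (hfeas _) (by simp [hD])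
  have m11 : (1, 1) ∉ A.run I D := hedge (hfeas _) (by simp [hD])
  rw [hval, hval, if_neg h0, if_neg m01, if_neg h1, if_neg m11] at h
  simp [v00] at h
  linarith

end BMP

theorem theorem4p1 (γ : ℝ) (hγ : 1 ≤ γ) (τ : BMP.TieBreakingRule) (σ : BMP.ChoiceRule) :
    (BMP.boost γ τ σ).IsGroupStrategyproof ∧
    (∀ etaHat : ℝ, 0 ≤ etaHat → etaHat ≤ 1 →
      (BMP.boost γ τ σ).IsApproximate etaHat
        (if etaHat ≤ 1 - 1 / γ then (1 + γ) / (γ * (1 - etaHat)) else 1 + γ)) ∧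
    (BMP.boost γ τ σ).IsConsistent (1 + 1 / γ) ∧
    (BMP.boost γ τ σ).IsRobust (1 + γ) ∧
    (∀ ε : ℝ, 0 < ε → ¬ ∃ A : BMP.Mechanism,
      A.IsStrategyproof ∧ A.IsConsistent (1 + 1 / γ) ∧ A.IsRobust (1 + γ - ε)) := by
  exact ⟨BMP.boost_isGroupStrategyproof hγ τ σ,
    fun etaHat _ _ => BMP.boost_isApproximate hγ τ σ etaHat, BMP.boost_isConsistent hγ τ σ,
    BMP.boost_isRobust hγ τ σ, fun _ hε => BMP.not_exists_strategyproof hγ hε⟩
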